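/- For a finite alphabet $\mathcal A$ equip $\mathcal A^{\mathbb Z^2}$ with the metric $d(x,y)=2^{-\min\{\|i\|_\infty : x_i\neq y_i\}}$ (and $d(x,x)=0$). A two-dimensional cellular automaton (2D CA) is a map $F:\mathcal A^{\mathbb Z^2}\to\mathcal A^{\mathbb Z^2}$ of the form $F(x)_m=f\big((x_{m+u})_{u\in U}\big)$, where $U\subset\mathbb Z^2$ is a finite neighborhood and $f:\mathcal A^U\to\mathcal A$ a local rule; it is given by the finite data $(\mathcal A,U,f)$. A point $x$ is an equicontinuous point of $F$ if for every $\epsilon>0$ there is $\delta>0$ such that $d(x,y)<\delta$ implies $d(F^n(x),F^n(y))<\epsilon$ for all $n\in\mathbb N$. $F$ is sensitive if there is $\epsilon>0$ such that for all $\delta>0$ and all $x$ there are $y$ and $n\in\mathbb N$ with $d(x,y)<\delta$ and $d(F^n(x),F^n(y))>\epsilon$. Let $\mathcal E_q$ be the class of 2D CA that have an equicontinuous point, $\mathcal S$ the class of sensitive 2D CA, and $\mathcal N$ the class of 2D CA that are neither in $\mathcal E_q$ nor in $\mathcal S$. A tile set is a finite set of tiles together with the list of its allowed horizontal ($2\times1$)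 and vertical ($1\times 2$) dominos; it tiles the plane if there is a map from $\mathbb Z^2$ to the tiles all of whose horizontal and vertical dominos are allowed. **Proposition.** There is a recursive function $\Phi_4$ that associates with every tile set $T$ a 2D CA $\Phi_4(T)$ such that $\Phi_4(T)\in\mathcal E_q$ if $T$ tiles the plane, and $\Phi_4(T)\in\mathcal N$ otherwise. -/

import Mathlib

/-- A finite set of tiles `{0, …, numTiles - 1}` with domino constraints: `horiz` lists the allowed
pairs (left tile, right tile) and `vert` the allowed pairs (lower tile, upper tile). Pairs that
mention a number `≥ numTiles` never occur and are harmless. -/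
structure TileSet where
  numTiles : ℕ
  horiz : List (ℕ × ℕ)
  vert : List (ℕ × ℕ)

namespace TileSet

/-- A tile set as a finite word of data; it carries the notion of recursive function. -/
def equivData : TileSet ≃ ℕ × List (ℕ × ℕ) × List (ℕ × ℕ) where
  toFun T := (T.numTiles, T.horiz, T.vert)
  invFun d := ⟨d.1, d.2.1, d.2.2⟩
  left_inv _ := rfl
  right_inv _ := rfl

instance instPrimcodable : Primcodable TileSet := Primcodable.ofEquiv _ equivData

/-- `T` tiles the plane: there is a map `ℤ² → {tiles}` in which every horizontal and every
vertical domino is allowed. -/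
def TilesPlane (T : TileSet) : Prop :=
  ∃ t : ℤ × ℤ → Fin T.numTiles, ∀ i j : ℤ,
    (((t (i, j) : ℕ), (t (i + 1, j) : ℕ)) ∈ T.horiz) ∧
    (((t (i, j) : ℕ), (t (i, j + 1) : ℕ)) ∈ T.vert)

end TileSet

/-- A two-dimensional cellular automaton as finite data: the alphabet is `{0, …, lastState}`, the
neighborhood is a finite list of vectors of `ℤ²`, and the local rule is a finite table that sends
a pattern (the list of the states at the neighborhood, in its order) to a state. A pattern that
is absent from the table is sent to the state `0`, so every datum denotes a cellular automaton,
and every local rule on a finite nonempty alphabet is given by its full table. -/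
structure PlaneCA where
  lastState : ℕ
  neighborhood : List (ℤ × ℤ)
  table : List (List ℕ × ℕ)

namespace PlaneCA

/-- A cellular automaton as a finite word of data; it carries the notion of recursive function. -/
def equivData : PlaneCA ≃ ℕ × List (ℤ × ℤ) × List (List ℕ × ℕ) where
  toFun G := (G.lastState, G.neighborhood, G.table)
  invFun d := ⟨d.1, d.2.1, d.2.2⟩
  left_inv _ := rfl
  right_inv _ := rfl

instance instPrimcodable : Primcodable PlaneCA := Primcodable.ofEquiv _ equivData

/-- The alphabet. -/
abbrev State (G : PlaneCA) : Type := Fin (G.lastState + 1)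

/-- The configuration space. -/
abbrev Config (G : PlaneCA) : Type := ℤ × ℤ → G.State

/-- The local rule, read off the table (entries are reduced modulo the number of states). -/
def localRule (G : PlaneCA) (w : List G.State) : G.State :=
  Fin.ofNat (G.lastState + 1) ((G.table.lookup (w.map fun a : G.State => a.val)).getD 0)

/-- The global map `F(x)_m = f((x_{m+u})_{u ∈ U})`. -/
def globalMap (G : PlaneCA) (x : G.Config) : G.Config :=
  fun m => G.localRule (G.neighborhood.map fun u => x (m + u))

end PlaneCA

open Classical in
/-- The distance `d_C(x, y) = 2 ^ (-min {‖i‖_∞ : x_i ≠ y_i})` on configurations,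
with `d_C(x, x) = 0`. -/
noncomputable def configDist {A : Type*} (x y : ℤ × ℤ → A) : ℝ :=
  if x = y then 0
  else (1 / 2 : ℝ) ^ sInf {k : ℕ | ∃ i : ℤ × ℤ, x i ≠ y i ∧ k = max i.1.natAbs i.2.natAbs}

/-- `x` is an equicontinuous point of `F` for the distance `d`. -/
def IsEquicontinuousPoint {X : Type*} (d : X → X → ℝ) (F : X → X) (x : X) : Prop :=
  ∀ ε : ℝ, 0 < ε → ∃ δ : ℝ, 0 < δ ∧ ∀ y : X, d x y < δ → ∀ n : ℕ, d (F^[n] x) (F^[n] y) < ε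

/-- `F` is sensitive to initial conditions for the distance `d`. -/
def IsSensitive {X : Type*} (d : X → X → ℝ) (F : X → X) : Prop :=
  ∃ ε : ℝ, 0 < ε ∧ ∀ δ : ℝ, 0 < δ → ∀ x : X, ∃ (y : X) (n : ℕ),
    d x y < δ ∧ ε < d (F^[n] x) (F^[n] y)

namespace PlaneCA

/-- The class `E_q`: cellular automata that have an equicontinuous point. -/
def classEq : Set PlaneCA :=
  {G | ∃ x : G.Config, IsEquicontinuousPoint configDist G.globalMap x}

/-- The class `S`: sensitive cellular automata. -/
def classS : Set PlaneCA :=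
  {G | IsSensitive configDist G.globalMap}

/-- The class `N`: cellular automata that are neither in `E_q` nor in `S`. -/
def classN : Set PlaneCA :=
  {G | G ∉ classEq ∧ G ∉ classS}

end PlaneCA

/-!
A cell of the automaton carries a tile, a role and a charge. Tile and role form the *skeleton*, which
evolves on its own: tiles never change, and a cell whose role does not fit to the neighbours it
relies on becomes free for ever. Besides the tiles of `T` there is a blank tile, and obstacles are
made of either kind. A *plain* obstacle has blank tiles and consists of a block of core cells inside
a single ring. A *tiled* obstacle is a family of concentric square rings around one core cell and
carries a valid partial tiling by `T`. Cells of a ring rely on the same ring and on the next one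
inwards, but never on the outside, whereas core cells rely on all neighbours. So a finished square
is immune to everything outside it, while a defect in the core of a plain block spreads through the
whole block.

A cell that fits to all four neighbours is solid and blocks charges. Every other cell copies the
charge of its eastern neighbour or, if that one is blocked, of its northern neighbour.

* Large plain blocks protect their core, so the automaton is never sensitive (`block_protected`).
* If `T` tiles the plane, concentric rings over a tiling protect every box around the origin, and
  this configuration is an equicontinuous point (`ring_protected`).
* If `T` does not tile the plane, no configuration `X` is an equicontinuous point
  (`exists_charge_eq`). Replace everything outside a large box by free cells of a constant charge
  `b`. The skeleton is now finite and becomes constant. In a stable skeleton a cell that is not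
  solid has an eastern or a northern neighbour that is not solid (`solid_of_east_of_north`), so its
  charge finally comes from outside the box and equals `b` (`charge_eventually`). Hence `X` could
  only be equicontinuous if, for every `k`, the box of radius `k` were solid in the final skeleton
  for some such truncation. By compactness a large solid box cannot carry proper tiles, so it is
  plain and consists of core cells of `X`. Then `X` has core cells only, and its truncations have no
  boundary ring and cannot leave a stable cell behind.

The automaton depends computably on `T`, because its table lists the values of a rule that combines
a fixed finite function with membership tests in the lists of dominos (`computable_ringCA`).
-/

/-! ### The local rule -/

namespace RingCA

/-- The role of a cell. `free` cells lie outside every obstacle; the others say where a cell sits in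
its obstacle: in the middle (`core`), on one of the four sides of a square ring around it, or on one
of the four corners of such a ring. -/
inductive Role
  | free | core | n | e | s | w | ne | nw | se | sw
  deriving DecidableEq

namespace Role

instance : Fintype Role :=
  ⟨{free, core, n, e, s, w, ne, nw, se, sw}, fun r => by cases r <;> decide⟩

/-- The reflection of the plane in its main diagonal, acting on roles. -/
def flip : Role → Role
  | n => e | e => n | s => w | w => s | nw => se | se => nw | r => r

/-- A cell with this role relies on its eastern neighbour. Side and corner cells rely on the next
ring inwards and on the neighbours along their own ring, but never on what lies outside. -/
def needsE : Role → Bool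
  | core | n | s | w | nw | sw => true
  | _ => false

/-- A cell with this role relies on its western neighbour. -/
def needsW : Role → Bool
  | core | n | s | e | ne | se => true
  | _ => false

/-- A cell with this role relies on its northern neighbour. -/
def needsN (r : Role) : Bool := r.flip.needsE

/-- A cell with this role relies on its southern neighbour. -/
def needsS (r : Role) : Bool := r.flip.needsW

/-- The roles that may stand side by side (left, right) in an obstacle. In a *tiled* obstacle (flag
`true`) these are the horizontal pairs of the partition of the plane into concentric square rings
around a single core cell; in a *plain* obstacle (flag `false`), those of a block of core cells
surrounded by a single ring. -/
def adjH : Bool → Role → Role → Bool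
  | _, w, core | _, core, e | _, nw, n | _, n, n | _, n, ne | _, sw, s | _, s, s | _, s, se => true
  | false, core, core => true
  | true, w, w | true, w, nw | true, w, sw | true, e, e | true, ne, e | true, se, e => true
  | _, _, _ => false

/-- The roles that may stand one above the other (lower, upper) in an obstacle. -/
def adjV (fl : Bool) (r r' : Role) : Bool := adjH fl r.flip r'.flip

end Role

open Role

/-- The connection between the tiles of two neighbouring cells, for `n` proper tiles and the allowed
dominos `L`. The number `n` serves as an additional blank tile. Two blanks are joined by a plain
connection `some false`, two proper tiles that form an allowed domino by a tiled connection
`some true`, and nothing else is connected. -/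
def link (n : ℕ) (L : List (ℕ × ℕ)) (a b : ℕ) : Option Bool :=
  if a = n ∧ b = n then some false else if a < n ∧ b < n ∧ (a, b) ∈ L then some true else none

/-- Two horizontal neighbours with connection `l` fit together. -/
def fitsH : Option Bool → Role → Role → Bool
  | some fl, r, r' => adjH fl r r'
  | none, _, _ => false

/-- Two vertical neighbours with connection `l` fit together. -/
def fitsV : Option Bool → Role → Role → Bool
  | some fl, r, r' => adjV fl r r'
  | none, _, _ => false

/-- A cell keeps its role if it fits to all the neighbours it relies on. The last two conditions
exclude two rings that touch at a north-eastern corner below (or to the left of) a common side of a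
further ring; in concentric rings they hold automatically. -/
def settled (oE oN oW oS : Bool) (r rE rN rW rS : Role) : Bool :=
  (!r.needsE || oE) && (!r.needsN || oN) && (!r.needsW || oW) && (!r.needsS || oS) &&
  (!(r = n && rS = ne) || rE = ne) && (!(r = e && rW = ne) || rN = ne)

/-- A cell: its tile and its role, and its charge. The charge `none` means that the cell is
blocked. -/
abbrev Cell : Type := (ℕ × Role) × Option Bool

/-- Horizontal neighbours (left, right), each with tile and role, fit together. -/
def joinH (T : TileSet) (a b : ℕ × Role) : Bool :=
  fitsH (link T.numTiles T.horiz a.1 b.1) a.2 b.2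

/-- Vertical neighbours (lower, upper), each with tile and role, fit together. -/
def joinV (T : TileSet) (a b : ℕ × Role) : Bool :=
  fitsV (link T.numTiles T.vert a.1 b.1) a.2 b.2

/-- The local rule, in terms of the cell and its four neighbours. A cell that is not settled becomes
free. A cell that fits to all four neighbours is blocked; any other cell takes over the charge of
its eastern neighbour or, if that one is blocked, of its northern neighbour. -/
def localCell (T : TileSet) (a cE cN cW cS : Cell) : Cell :=
  ((a.1.1,
    if settled (joinH T a.1 cE.1) (joinV T a.1 cN.1) (joinH T cW.1 a.1) (joinV T cS.1 a.1)
      a.1.2 cE.1.2 cN.1.2 cW.1.2 cS.1.2 then a.1.2 else free),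
    if joinH T a.1 cE.1 && joinV T a.1 cN.1 && joinH T cW.1 a.1 && joinV T cS.1 a.1 then none
    else some ((cE.2 <|> cN.2).getD false))

/-! ### The dynamics on the plane -/

/-- The eastern neighbour. -/
def east (m : ℤ × ℤ) : ℤ × ℤ := (m.1 + 1, m.2)
/-- The northern neighbour. -/
def north (m : ℤ × ℤ) : ℤ × ℤ := (m.1, m.2 + 1)
/-- The western neighbour. -/
def west (m : ℤ × ℤ) : ℤ × ℤ := (m.1 - 1, m.2)
/-- The southern neighbour. -/
def south (m : ℤ × ℤ) : ℤ × ℤ := (m.1, m.2 - 1)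

@[simp] lemma east_west (m : ℤ × ℤ) : east (west m) = m := by simp [east, west]
@[simp] lemma west_east (m : ℤ × ℤ) : west (east m) = m := by simp [east, west]
@[simp] lemma north_south (m : ℤ × ℤ) : north (south m) = m := by simp [north, south]
@[simp] lemma south_north (m : ℤ × ℤ) : south (north m) = m := by simp [north, south]
lemma west_north (m : ℤ × ℤ) : west (north m) = north (west m) := rfl
lemma south_east (m : ℤ × ℤ) : south (east m) = east (south m) := rfl

/-- The tiles and roles of all cells. They evolve independently of the charges. -/
abbrev Skeleton : Type := ℤ × ℤ → ℕ × Role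

/-- The cell at `m` fits to its eastern neighbour. -/
def OkE (T : TileSet) (σ : Skeleton) (m : ℤ × ℤ) : Prop := joinH T (σ m) (σ (east m)) = true

/-- The cell at `m` fits to its northern neighbour. -/
def OkN (T : TileSet) (σ : Skeleton) (m : ℤ × ℤ) : Prop := joinV T (σ m) (σ (north m)) = true

/-- The cell at `m` keeps its role. -/
structure Stable (T : TileSet) (σ : Skeleton) (m : ℤ × ℤ) : Prop where
  okE : (σ m).2.needsE = true → OkE T σ m
  okN : (σ m).2.needsN = true → OkN T σ m
  okW : (σ m).2.needsW = true → OkE T σ (west m)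
  okS : (σ m).2.needsS = true → OkN T σ (south m)
  cornerN : (σ m).2 = n → (σ (south m)).2 = ne → (σ (east m)).2 = ne
  cornerE : (σ m).2 = e → (σ (west m)).2 = ne → (σ (north m)).2 = ne

/-- The cell at `m` fits to all its neighbours. -/
structure Solid (T : TileSet) (σ : Skeleton) (m : ℤ × ℤ) : Prop where
  okE : OkE T σ m
  okN : OkN T σ m
  okW : OkE T σ (west m)
  okS : OkN T σ (south m)

open Classical in
/-- The evolution of tiles and roles. -/
noncomputable def evolve (T : TileSet) (σ : Skeleton) : Skeleton :=
  fun m => ((σ m).1, if Stable T σ m then (σ m).2 else free)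

/-- A configuration of cells on the plane. -/
abbrev Conf : Type := ℤ × ℤ → Cell

/-- The tiles and roles of a configuration. -/
def skel (X : Conf) : Skeleton := fun m => (X m).1

/-- The global map of the local rule `localCell`. -/
def step (T : TileSet) (X : Conf) : Conf :=
  fun m => localCell T (X m) (X (east m)) (X (north m)) (X (west m)) (X (south m))

lemma skel_step (T : TileSet) (X : Conf) : skel (step T X) = evolve T (skel X) := by
  funext m
  have : (settled (joinH T (X m).1 (X (east m)).1) (joinV T (X m).1 (X (north m)).1)
      (joinH T (X (west m)).1 (X m).1) (joinV T (X (south m)).1 (X m).1)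
      (X m).1.2 (X (east m)).1.2 (X (north m)).1.2 (X (west m)).1.2 (X (south m)).1.2 = true) ↔
      Stable T (skel X) m := by
    simp only [settled, Bool.and_eq_true, Bool.or_eq_true, Bool.not_eq_true', decide_eq_true_eq,
      ← Bool.not_eq_true]
    constructor
    · rintro ⟨⟨⟨⟨⟨h1, h2⟩, h3⟩, h4⟩, h5⟩, h6⟩
      refine ⟨fun h => ?_, fun h => ?_, fun h => ?_, fun h => ?_, fun h h' => ?_, fun h h' => ?_⟩
      · exact h1.resolve_left (not_not_intro h)
      · exact h2.resolve_left (not_not_intro h)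
      · simpa [OkE, skel] using h3.resolve_left (not_not_intro h)
      · simpa [OkN, skel] using h4.resolve_left (not_not_intro h)
      · exact h5.resolve_left fun g => g ⟨h, h'⟩
      · exact h6.resolve_left fun g => g ⟨h, h'⟩
    · rintro ⟨h1, h2, h3, h4, h5, h6⟩
      simp only [OkE, OkN, east_west, north_south] at h1 h2 h3 h4
      refine ⟨⟨⟨⟨⟨?_, ?_⟩, ?_⟩, ?_⟩, ?_⟩, ?_⟩
      · exact or_iff_not_imp_left.2 fun h => h1 (not_not.1 h)
      · exact or_iff_not_imp_left.2 fun h => h2 (not_not.1 h)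
      · exact or_iff_not_imp_left.2 fun h => h3 (not_not.1 h)
      · exact or_iff_not_imp_left.2 fun h => h4 (not_not.1 h)
      · refine or_iff_not_imp_left.2 fun h => ?_
        push Not at h
        exact h5 h.1 h.2
      · refine or_iff_not_imp_left.2 fun h => ?_
        push Not at h
        exact h6 h.1 h.2
  simp only [skel, step, localCell, evolve]
  congr 1
  by_cases h : Stable T (skel X) m
  · rw [if_pos (this.2 h), if_pos h]
  · rw [if_neg (fun g => h (this.1 g)), if_neg h]

lemma skel_iterate_step (T : TileSet) (X : Conf) (t : ℕ) :
    skel ((step T)^[t] X) = (evolve T)^[t] (skel X) := by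
  induction t with
  | zero => rfl
  | succ t ih => rw [Function.iterate_succ_apply', Function.iterate_succ_apply', skel_step, ih]

open Classical in
lemma step_charge (T : TileSet) (X : Conf) (m : ℤ × ℤ) :
    (step T X m).2 = if Solid T (skel X) m then none
      else some (((X (east m)).2 <|> (X (north m)).2).getD false) := by
  have : (joinH T (X m).1 (X (east m)).1 && joinV T (X m).1 (X (north m)).1 &&
      joinH T (X (west m)).1 (X m).1 && joinV T (X (south m)).1 (X m).1) = true ↔
      Solid T (skel X) m := by
    simp only [Bool.and_eq_true]
    constructor
    · rintro ⟨⟨⟨h1, h2⟩, h3⟩, h4⟩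
      exact ⟨h1, h2, by simpa [OkE, skel] using h3, by simpa [OkN, skel] using h4⟩
    · rintro ⟨h1, h2, h3, h4⟩
      simp only [OkE, OkN, east_west, north_south] at h1 h2 h3 h4
      exact ⟨⟨⟨h1, h2⟩, h3⟩, h4⟩
  simp only [step, localCell]
  by_cases h : Solid T (skel X) m
  · rw [if_pos (this.2 h), if_pos h]
  · rw [if_neg (fun g => h (this.1 g)), if_neg h]

/-! ### Free passage around stable obstacles -/

lemma link_eq_some {n : ℕ} {L : List (ℕ × ℕ)} {a b : ℕ} {fl : Bool} (h : link n L a b = some fl) :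
    fl = decide (a ≠ n) ∧ fl = decide (b ≠ n) ∧ (fl = true → a < n ∧ b < n ∧ (a, b) ∈ L) := by
  unfold link at h
  split_ifs at h with h1 h2
  · cases h; simp [h1.1, h1.2]
  · cases h; simp [h2, h2.1.ne, h2.2.1.ne]

lemma link_self (n : ℕ) (L : List (ℕ × ℕ)) : link n L n n = some false := by simp [link]

lemma link_of_mem {n : ℕ} {L : List (ℕ × ℕ)} {a b : ℕ} (ha : a < n) (hb : b < n)
    (h : (a, b) ∈ L) : link n L a b = some true := by
  simp [link, ha, hb, h, ha.ne]

lemma OkE.spec {T : TileSet} {σ : Skeleton} {m : ℤ × ℤ} (h : OkE T σ m) :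
    ∃ fl : Bool, fl = decide ((σ m).1 ≠ T.numTiles) ∧ fl = decide ((σ (east m)).1 ≠ T.numTiles) ∧
      adjH fl (σ m).2 (σ (east m)).2 = true ∧ (fl = true → (σ m).1 < T.numTiles ∧
        (σ (east m)).1 < T.numTiles ∧ ((σ m).1, (σ (east m)).1) ∈ T.horiz) := by
  unfold OkE joinH at h
  rcases hl : link T.numTiles T.horiz (σ m).1 (σ (east m)).1 with _ | fl
  · rw [hl] at h; simp [fitsH] at h
  · rw [hl] at h
    obtain ⟨h1, h2, h3⟩ := link_eq_some hl
    exact ⟨fl, h1, h2, h, h3⟩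

lemma OkN.spec {T : TileSet} {σ : Skeleton} {m : ℤ × ℤ} (h : OkN T σ m) :
    ∃ fl : Bool, fl = decide ((σ m).1 ≠ T.numTiles) ∧ fl = decide ((σ (north m)).1 ≠ T.numTiles) ∧
      adjV fl (σ m).2 (σ (north m)).2 = true ∧ (fl = true → (σ m).1 < T.numTiles ∧
        (σ (north m)).1 < T.numTiles ∧ ((σ m).1, (σ (north m)).1) ∈ T.vert) := by
  unfold OkN joinV at h
  rcases hl : link T.numTiles T.vert (σ m).1 (σ (north m)).1 with _ | fl
  · rw [hl] at h; simp [fitsV] at h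
  · rw [hl] at h
    obtain ⟨h1, h2, h3⟩ := link_eq_some hl
    exact ⟨fl, h1, h2, h, h3⟩

/-- A reflex corner at a cell `a` that does not rely on its western neighbour `aw`: if `c` is north of
`a` and `cw` is west of `c`, then `cw` relies on `aw`. -/
lemma needsS_of_adj : ∀ (fl : Bool) (a c cw : Role), a.needsW = false → adjV fl a c = true →
    adjH fl cw c = true → cw.needsS = true := by decide

set_option maxRecDepth 100000 in
/-- In the situation of `needsS_of_adj`, the cell `aw` relies on `a`, so that `aw` and `a` fit. Here
the corner condition in `settled` is indispensable. -/
lemma needsE_of_adj : ∀ (fl : Bool) (a c : Role), a.needsW = false → adjV fl a c = true →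
    ∀ cw : Role, adjH fl cw c = true → ∀ aw : Role, adjV fl aw cw = true →
    (cw = n → aw = ne → c = ne) → aw.needsE = true := by decide

lemma flip_flip : ∀ r : Role, r.flip.flip = r := by decide

/-- The reason why charges find a way around obstacles: in a stable skeleton, the cells that are not
solid form a set from every point of which one can leave to the east or to the north without
entering a solid cell. If both neighbours are solid, a reflex corner of an obstacle would be needed,
and the roles allow no such corner. -/
theorem solid_of_east_of_north {T : TileSet} {σ : Skeleton} (hσ : ∀ m, Stable T σ m) {m : ℤ × ℤ}
    (hE : Solid T σ (east m)) (hN : Solid T σ (north m)) : Solid T σ m := by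
  have hmE : OkE T σ m := by simpa using hE.okW
  have hmN : OkN T σ m := by simpa using hN.okS
  refine ⟨hmE, hmN, ?_, ?_⟩
  · rcases ha : (σ m).2.needsW with _ | _
    · obtain ⟨f1, p1, q1, a1, -⟩ := hmN.spec
      have h2 := hN.okW
      obtain ⟨f2, p2, q2, a2, -⟩ := h2.spec
      rw [east_west] at q2 a2
      obtain rfl : f2 = f1 := by rw [q1, q2]
      have h3 : OkN T σ (west m) := by
        have := (hσ (west (north m))).okS (needsS_of_adj _ _ _ _ ha a1 a2)
        rwa [west_north, south_north] at this
      obtain ⟨f3, p3, q3, a3, -⟩ := h3.spec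
      rw [← west_north] at q3 a3
      obtain rfl : f3 = f2 := by rw [q3, p2]
      refine (hσ (west m)).okE (needsE_of_adj _ _ _ ha a1 _ a2 _ a3 fun h h' => ?_)
      have := (hσ (west (north m))).cornerN h (by rwa [west_north, south_north])
      rwa [east_west] at this
    · exact (hσ m).okW ha
  -- The southern neighbour is treated like the western one, after a reflection in the diagonal.
  · rcases ha : (σ m).2.needsS with _ | _
    · obtain ⟨f1, p1, q1, a1, -⟩ := hmE.spec
      have h2 := hE.okS
      obtain ⟨f2, p2, q2, a2, -⟩ := h2.spec
      rw [north_south] at q2 a2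
      obtain rfl : f2 = f1 := by rw [q1, q2]
      have a1' : adjV f2 (σ m).2.flip (σ (east m)).2.flip = true := by
        simpa only [adjV, flip_flip] using a1
      have h3 : OkE T σ (south m) := by
        have := (hσ (south (east m))).okW (by
          have := needsS_of_adj _ _ _ _ ha a1' a2
          rwa [needsS, flip_flip] at this)
        rwa [south_east, west_east] at this
      obtain ⟨f3, p3, q3, a3, -⟩ := h3.spec
      rw [← south_east] at q3 a3
      obtain rfl : f3 = f2 := by rw [q3, p2]
      refine (hσ (south m)).okN (needsE_of_adj _ _ _ ha a1' _ a2 _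
        (by simpa only [adjV, flip_flip] using a3) fun h h' => ?_)
      have h5 : (σ (south (east m))).2 = e := by rw [← flip_flip (σ _).2, h]; rfl
      have h6 : (σ (south m)).2 = ne := by rw [← flip_flip (σ _).2, h']; rfl
      have := (hσ (south (east m))).cornerE h5 (by rwa [south_east, west_east])
      rw [north_south] at this
      rw [this]; rfl
    · exact (hσ m).okS ha


/-! ### Protected regions -/

/-- The box of cells at sup-distance at most `k` from the origin. -/
def Box (k : ℕ) : Set (ℤ × ℤ) := {m | m.1.natAbs ≤ k ∧ m.2.natAbs ≤ k}

/-- Stability at `m` depends only on the cell and on the neighbours on which it relies. -/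
lemma Stable.congr {T : TileSet} {σ τ : Skeleton} {m : ℤ × ℤ} (h : Stable T σ m)
    (h0 : τ m = σ m) (hE : (σ m).2.needsE = true → τ (east m) = σ (east m))
    (hN : (σ m).2.needsN = true → τ (north m) = σ (north m))
    (hW : (σ m).2.needsW = true → τ (west m) = σ (west m))
    (hS : (σ m).2.needsS = true → τ (south m) = σ (south m)) : Stable T τ m := by
  refine ⟨fun g => ?_, fun g => ?_, fun g => ?_, fun g => ?_, fun g g' => ?_, fun g g' => ?_⟩
  · rw [h0] at g
    rw [OkE, h0, hE g]
    exact h.okE g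
  · rw [h0] at g
    rw [OkN, h0, hN g]
    exact h.okN g
  · rw [h0] at g
    rw [OkE, east_west, h0, hW g]
    simpa [OkE] using h.okW g
  · rw [h0] at g
    rw [OkN, north_south, h0, hS g]
    simpa [OkN] using h.okS g
  · rw [h0] at g
    rw [hS (by rw [g]; rfl)] at g'
    rw [hE (by rw [g]; rfl)]
    exact h.cornerN g g'
  · rw [h0] at g
    rw [hW (by rw [g]; rfl)] at g'
    rw [hN (by rw [g]; rfl)]
    exact h.cornerE g g'

lemma Solid.congr {T : TileSet} {σ τ : Skeleton} {m : ℤ × ℤ} (h : Solid T σ m)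
    (h0 : τ m = σ m) (hE : τ (east m) = σ (east m)) (hN : τ (north m) = σ (north m))
    (hW : τ (west m) = σ (west m)) (hS : τ (south m) = σ (south m)) : Solid T τ m := by
  refine ⟨?_, ?_, ?_, ?_⟩
  · rw [OkE, h0, hE]; exact h.okE
  · rw [OkN, h0, hN]; exact h.okN
  · rw [OkE, east_west, h0, hW]; simpa [OkE] using h.okW
  · rw [OkN, north_south, h0, hS]; simpa [OkN] using h.okS

/-- A box in which every cell is stable and relies only on cells of the box keeps its skeleton
whatever happens outside, and its solid interior stays blocked. -/
theorem protected_box {T : TileSet} {σ : Skeleton} {k : ℕ}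
    (hst : ∀ m ∈ Box (k + 1), Stable T σ m)
    (hE : ∀ m ∈ Box (k + 1), (σ m).2.needsE = true → east m ∈ Box (k + 1))
    (hN : ∀ m ∈ Box (k + 1), (σ m).2.needsN = true → north m ∈ Box (k + 1))
    (hW : ∀ m ∈ Box (k + 1), (σ m).2.needsW = true → west m ∈ Box (k + 1))
    (hS : ∀ m ∈ Box (k + 1), (σ m).2.needsS = true → south m ∈ Box (k + 1))
    (hsol : ∀ m ∈ Box k, Solid T σ m)
    {Y : Conf} (hY : ∀ m ∈ Box (k + 1), Y m = (σ m, none)) (t : ℕ) :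
    ∀ m ∈ Box k, (step T)^[t] Y m = (σ m, none) := by
  suffices h : (∀ m ∈ Box (k + 1), skel ((step T)^[t] Y) m = σ m) ∧
      ∀ m ∈ Box k, ((step T)^[t] Y m).2 = none by
    intro m hm
    exact Prod.ext (h.1 m ⟨hm.1.trans k.le_succ, hm.2.trans k.le_succ⟩) (h.2 m hm)
  induction t with
  | zero =>
    refine ⟨fun m hm => ?_, fun m hm => ?_⟩
    · simp [skel, hY m hm]
    · simp [hY m ⟨hm.1.trans k.le_succ, hm.2.trans k.le_succ⟩]
  | succ t ih =>
    obtain ⟨ih, -⟩ := ih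
    rw [Function.iterate_succ_apply']
    constructor
    · intro m hm
      have : Stable T (skel ((step T)^[t] Y)) m :=
        (hst m hm).congr (ih m hm) (fun h => ih _ (hE m hm h)) (fun h => ih _ (hN m hm h))
          (fun h => ih _ (hW m hm h)) (fun h => ih _ (hS m hm h))
      rw [skel_step, evolve, if_pos this, ih m hm]
    · intro m hm
      have hb : ∀ m', m'.1.natAbs ≤ k + 1 ∧ m'.2.natAbs ≤ k + 1 → m' ∈ Box (k + 1) :=
        fun _ h => h
      obtain ⟨h1, h2⟩ := hm
      have : Solid T (skel ((step T)^[t] Y)) m :=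
        (hsol m ⟨h1, h2⟩).congr (ih _ (hb _ (by omega)))
          (ih _ (hb _ (by simp only [east]; omega))) (ih _ (hb _ (by simp only [north]; omega)))
          (ih _ (hb _ (by simp only [west]; omega))) (ih _ (hb _ (by simp only [south]; omega)))
      rw [step_charge, if_pos this]

/-! ### Squares centred at the origin -/

/-- The role at a given position (horizontally, vertically) relative to the middle of a square:
`lt` and `gt` stand for the two ends and `eq` for what is in between. -/
def roleAt : Ordering → Ordering → Role
  | .eq, .eq => core | .eq, .gt => n | .gt, .eq => e | .eq, .lt => s | .lt, .eq => w
  | .gt, .gt => ne | .lt, .gt => nw | .gt, .lt => se | .lt, .lt => sw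

lemma flip_roleAt : ∀ a b, (roleAt a b).flip = roleAt b a := by
  intro a b; cases a <;> cases b <;> rfl

/-- The position of the coordinate `i` relative to the interval `[-k, k]`. -/
def blockSide (k : ℕ) (i : ℤ) : Ordering :=
  if i < -k then .lt else if (k : ℤ) < i then .gt else .eq

/-- The skeleton of a plain block with core `Box k`, surrounded by a single ring. The cells outside
`Box (k + 1)` are irrelevant. -/
def blockSkel (T : TileSet) (k : ℕ) : Skeleton :=
  fun m => (T.numTiles, roleAt (blockSide k m.1) (blockSide k m.2))

lemma adjH_block {k : ℕ} {i j : ℤ} (h1 : -(k + 1) ≤ i) (h2 : i ≤ k) :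
    adjH false (roleAt (blockSide k i) (blockSide k j))
      (roleAt (blockSide k (i + 1)) (blockSide k j)) = true := by
  generalize blockSide k j = b
  unfold blockSide
  split_ifs <;> first | omega | (cases b <;> rfl)

lemma okE_block (T : TileSet) {k : ℕ} {m : ℤ × ℤ} (h1 : -(k + 1) ≤ m.1) (h2 : m.1 ≤ k) :
    OkE T (blockSkel T k) m := by
  simpa [OkE, joinH, blockSkel, link_self, fitsH, east] using adjH_block h1 h2

lemma okN_block (T : TileSet) {k : ℕ} {m : ℤ × ℤ} (h1 : -(k + 1) ≤ m.2) (h2 : m.2 ≤ k) :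
    OkN T (blockSkel T k) m := by
  simpa [OkN, joinV, blockSkel, link_self, fitsV, north, adjV, flip_roleAt] using adjH_block h1 h2

lemma blockSide_of_needsE {k : ℕ} {i : ℤ} {b : Ordering}
    (h : (roleAt (blockSide k i) b).needsE = true) : i ≤ k := by
  by_contra! g
  rw [show blockSide k i = .gt by rw [blockSide, if_neg (by omega), if_pos g]] at h
  cases b <;> simp [roleAt, needsE] at h

lemma blockSide_of_needsW {k : ℕ} {i : ℤ} {b : Ordering}
    (h : (roleAt (blockSide k i) b).needsW = true) : -k ≤ i := by
  by_contra! g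
  rw [show blockSide k i = .lt by rw [blockSide, if_pos g]] at h
  cases b <;> simp [roleAt, needsW] at h

/-- A plain block with a large core is a pattern that protects its core for ever. -/
theorem block_protected (T : TileSet) {k : ℕ} {Y : Conf}
    (hY : ∀ m ∈ Box (k + 1), Y m = (blockSkel T k m, none)) (t : ℕ) :
    ∀ m ∈ Box k, (step T)^[t] Y m = (blockSkel T k m, none) := by
  have hN : ∀ m, (blockSkel T k m).2.needsN = true → m.2 ≤ k := fun m h => by
    rw [needsN, blockSkel, flip_roleAt] at h; exact blockSide_of_needsE h
  have hS : ∀ m, (blockSkel T k m).2.needsS = true → -k ≤ m.2 := fun m h => by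
    rw [needsS, blockSkel, flip_roleAt] at h; exact blockSide_of_needsW h
  refine protected_box (fun m hm => ?_) (fun m hm h => ?_) (fun m hm h => ?_) (fun m hm h => ?_)
    (fun m hm h => ?_) (fun m hm => ?_) hY t
  · obtain ⟨h1, h2⟩ := hm
    refine ⟨fun h => okE_block T (by omega) (blockSide_of_needsE h),
      fun h => okN_block T (by omega) (hN m h), fun h => okE_block T ?_ ?_,
      fun h => okN_block T ?_ ?_, fun h h' => ?_, fun h h' => ?_⟩
    · have := blockSide_of_needsW h
      simp only [west]; omega
    · simp only [west]; omega
    · have := hS m h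
      simp only [south]; omega
    · simp only [south]; omega
    -- In a plain block nothing stands above or to the right of a north-eastern corner.
    · have := okN_block T (k := k) (m := south m)
        (by have := hS m (by rw [h]; rfl)
            simp only [south]; omega)
        (by simp only [south]; omega)
      obtain ⟨fl, p, q, r, -⟩ := this.spec
      rw [north_south] at r
      simp only [blockSkel, ne_eq, not_true_eq_false, decide_false] at p
      rw [p, h, h'] at r
      exact absurd r (by decide)
    · have := okE_block T (k := k) (m := west m)
        (by have := blockSide_of_needsW (k := k) (i := m.1) (b := blockSide k m.2)
              (by rw [show roleAt _ _ = e from h]; rfl)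
            simp only [west]; omega)
        (by simp only [west]; omega)
      obtain ⟨fl, p, q, r, -⟩ := this.spec
      rw [east_west] at r
      simp only [blockSkel, ne_eq, not_true_eq_false, decide_false] at p
      rw [p, h, h'] at r
      exact absurd r (by decide)
  · obtain ⟨h1, h2⟩ := hm
    have := blockSide_of_needsE h
    constructor <;> simp only [east] <;> omega
  · obtain ⟨h1, h2⟩ := hm
    have := hN m h
    constructor <;> simp only [north] <;> omega
  · obtain ⟨h1, h2⟩ := hm
    have := blockSide_of_needsW h
    constructor <;> simp only [west] <;> omega
  · obtain ⟨h1, h2⟩ := hm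
    have := hS m h
    constructor <;> simp only [south] <;> omega
  · obtain ⟨h1, h2⟩ := hm
    refine ⟨okE_block T ?_ ?_, okN_block T ?_ ?_, okE_block T ?_ ?_, okN_block T ?_ ?_⟩ <;>
      first | omega | (simp only [west, south]; omega)

/-- The position of the coordinate `i` on the square ring through a cell with coordinates `i` and
`j` (in any order). -/
def ringSide (i j : ℤ) : Ordering :=
  if i.natAbs < j.natAbs ∨ i = 0 then .eq else if i < 0 then .lt else .gt

/-- Concentric rings around the origin, carrying the tiling `t`. -/
def ringSkel {T : TileSet} (t : ℤ × ℤ → Fin T.numTiles) : Skeleton :=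
  fun m => (t m, roleAt (ringSide m.1 m.2) (ringSide m.2 m.1))

lemma adjH_ring (i j : ℤ) :
    adjH true (roleAt (ringSide i j) (ringSide j i))
      (roleAt (ringSide (i + 1) j) (ringSide j (i + 1))) = true := by
  unfold ringSide
  split_ifs <;> first | rfl | omega

lemma ringSide_of_needsE {i j : ℤ} (h : (roleAt (ringSide i j) (ringSide j i)).needsE = true) :
    (i + 1).natAbs ≤ max 1 (max i.natAbs j.natAbs) := by
  revert h
  unfold ringSide
  split_ifs <;> first | omega | (intro; omega) | simp [roleAt, needsE]

lemma ringSide_of_needsW {i j : ℤ} (h : (roleAt (ringSide i j) (ringSide j i)).needsW = true) :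
    (i - 1).natAbs ≤ max 1 (max i.natAbs j.natAbs) := by
  revert h
  unfold ringSide
  split_ifs <;> first | omega | (intro; omega) | simp [roleAt, needsW]

lemma roleAt_ring_eq_ne {i j : ℤ} :
    roleAt (ringSide i j) (ringSide j i) = ne ↔ i = j ∧ 0 < i := by
  unfold ringSide
  split_ifs <;> simp [roleAt] <;> omega

lemma roleAt_ring_eq_n {i j : ℤ} :
    roleAt (ringSide i j) (ringSide j i) = n ↔ i.natAbs < j.natAbs ∧ 0 < j := by
  unfold ringSide
  split_ifs <;> simp [roleAt] <;> omega

lemma roleAt_ring_eq_e {i j : ℤ} :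
    roleAt (ringSide i j) (ringSide j i) = e ↔ j.natAbs < i.natAbs ∧ 0 < i := by
  unfold ringSide
  split_ifs <;> simp [roleAt] <;> omega

/-- Concentric rings over a tiling of the plane protect every box around the origin: no ring relies
on what is outside. -/
theorem ring_protected {T : TileSet} {t : ℤ × ℤ → Fin T.numTiles}
    (ht : ∀ i j : ℤ, ((t (i, j) : ℕ), (t (i + 1, j) : ℕ)) ∈ T.horiz ∧
      ((t (i, j) : ℕ), (t (i, j + 1) : ℕ)) ∈ T.vert) {k : ℕ} {Y : Conf}
    (hY : ∀ m ∈ Box (k + 1), Y m = (ringSkel t m, none)) (τ : ℕ) :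
    ∀ m ∈ Box k, (step T)^[τ] Y m = (ringSkel t m, none) := by
  have hE : ∀ m, OkE T (ringSkel t) m := fun m => by
    unfold OkE joinH ringSkel
    rw [link_of_mem (t m).2 (t (east m)).2 (ht m.1 m.2).1]
    exact adjH_ring m.1 m.2
  have hN : ∀ m, OkN T (ringSkel t) m := fun m => by
    unfold OkN joinV ringSkel
    rw [link_of_mem (t m).2 (t (north m)).2 (ht m.1 m.2).2, fitsV, adjV, flip_roleAt, flip_roleAt]
    exact adjH_ring m.2 m.1
  refine protected_box (fun m hm => ⟨fun _ => hE _, fun _ => hN _, fun _ => hE _, fun _ => hN _,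
      fun h h' => ?_, fun h h' => ?_⟩) (fun m hm h => ?_) (fun m hm h => ?_) (fun m hm h => ?_)
    (fun m hm h => ?_) (fun m _ => ⟨hE _, hN _, hE _, hN _⟩) hY τ
  · simp only [ringSkel, roleAt_ring_eq_ne, roleAt_ring_eq_n, east, south] at *
    omega
  · simp only [ringSkel, roleAt_ring_eq_ne, roleAt_ring_eq_e, west, north] at *
    omega
  · have := ringSide_of_needsE h
    obtain ⟨h1, h2⟩ := hm
    constructor <;> simp only [east] <;> omega
  · rw [needsN, ringSkel, flip_roleAt] at h
    have := ringSide_of_needsE h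
    obtain ⟨h1, h2⟩ := hm
    constructor <;> simp only [north] <;> omega
  · have := ringSide_of_needsW h
    obtain ⟨h1, h2⟩ := hm
    constructor <;> simp only [west] <;> omega
  · rw [needsS, ringSkel, flip_roleAt] at h
    have := ringSide_of_needsW h
    obtain ⟨h1, h2⟩ := hm
    constructor <;> simp only [south] <;> omega


/-! ### Compactness for tilings -/

/-- A tile set that tiles arbitrarily large boxes tiles the plane. -/
theorem tilesPlane_of_forall_box {T : TileSet}
    (h : ∀ k : ℕ, ∃ t : ℤ × ℤ → Fin T.numTiles, ∀ m ∈ Box k,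
      ((t m : ℕ), (t (east m) : ℕ)) ∈ T.horiz ∧ ((t m : ℕ), (t (north m) : ℕ)) ∈ T.vert) :
    T.TilesPlane := by
  let S : ℕ → Set (ℤ × ℤ → Fin T.numTiles) := fun k => {t | ∀ m ∈ Box k,
      ((t m : ℕ), (t (east m) : ℕ)) ∈ T.horiz ∧ ((t m : ℕ), (t (north m) : ℕ)) ∈ T.vert}
  have hcl : ∀ k, IsClosed (S k) := by
    intro k
    have (a b : ℤ × ℤ) (L : List (ℕ × ℕ)) :
        IsClosed {t : ℤ × ℤ → Fin T.numTiles | ((t a : ℕ), (t b : ℕ)) ∈ L} := by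
      have hc : Continuous fun t : ℤ × ℤ → Fin T.numTiles => (t a, t b) :=
        (continuous_apply a).prodMk (continuous_apply b)
      exact IsClosed.preimage hc (isClosed_discrete {p | ((p.1 : ℕ), (p.2 : ℕ)) ∈ L})
    have hS : S k = ⋂ m ∈ Box k, {t | ((t m : ℕ), (t (east m) : ℕ)) ∈ T.horiz} ∩
        {t | ((t m : ℕ), (t (north m) : ℕ)) ∈ T.vert} := by
      ext t; simp [S]
    rw [hS]
    exact isClosed_biInter fun m _ => (this _ _ _).inter (this _ _ _)
  obtain ⟨t, ht⟩ := IsCompact.nonempty_iInter_of_sequence_nonempty_isCompact_isClosed S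
    (fun k t ht m hm => ht m ⟨hm.1.trans k.le_succ, hm.2.trans k.le_succ⟩) h
    (hcl 0).isCompact hcl
  refine ⟨t, fun i j => ?_⟩
  exact Set.mem_iInter.1 ht (max i.natAbs j.natAbs) (i, j) ⟨le_max_left _ _, le_max_right _ _⟩

/-! ### Stabilization of finite skeletons -/

lemma evolve_fst (T : TileSet) (σ : Skeleton) (m : ℤ × ℤ) : (evolve T σ m).1 = (σ m).1 := rfl

lemma evolve_snd (T : TileSet) (σ : Skeleton) (m : ℤ × ℤ) :
    (evolve T σ m).2 = (σ m).2 ∨ (evolve T σ m).2 = free := by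
  unfold evolve
  split_ifs <;> simp

lemma iterate_evolve_snd (T : TileSet) (σ : Skeleton) (t : ℕ) (m : ℤ × ℤ) :
    ((evolve T)^[t] σ m).2 = (σ m).2 ∨ ((evolve T)^[t] σ m).2 = free := by
  induction t with
  | zero => exact Or.inl rfl
  | succ t ih =>
    rw [Function.iterate_succ_apply']
    rcases evolve_snd T ((evolve T)^[t] σ) m with h | h
    · rwa [h]
    · exact Or.inr h

lemma iterate_evolve_of_free {T : TileSet} {σ : Skeleton} {m : ℤ × ℤ} (h : (σ m).2 = free)
    (t : ℕ) : ((evolve T)^[t] σ m).2 = free := by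
  rcases iterate_evolve_snd T σ t m with g | g
  · rw [g, h]
  · exact g

/-- A skeleton with finitely many cells that are not free becomes constant. -/
theorem exists_evolve_fixed (T : TileSet) {σ : Skeleton} {R : ℕ}
    (hσ : ∀ m, m ∉ Box R → (σ m).2 = free) :
    ∃ τ, evolve T ((evolve T)^[τ] σ) = (evolve T)^[τ] σ := by
  classical
  by_contra! hne
  let B : Finset (ℤ × ℤ) := Finset.Icc (-(R : ℤ)) R ×ˢ Finset.Icc (-(R : ℤ)) R
  let f : ℕ → ℕ := fun t => (B.filter fun m => ((evolve T)^[t] σ m).2 ≠ free).card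
  have hf : ∀ t, f (t + 1) < f t := by
    intro t
    refine Finset.card_lt_card (Finset.ssubset_iff_subset_ne.2 ⟨fun m hm => ?_, fun heq => ?_⟩)
    · simp only [Finset.mem_filter, Function.iterate_succ_apply'] at hm ⊢
      refine ⟨hm.1, fun h => hm.2 ?_⟩
      rcases evolve_snd T ((evolve T)^[t] σ) m with g | g
      · rw [g, h]
      · exact g
    · refine hne t (funext fun m => Prod.ext (evolve_fst _ _ _) ?_)
      rcases evolve_snd T ((evolve T)^[t] σ) m with g | g
      · exact g
      · rw [g]
        by_contra h
        have hB : m ∈ B := by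
          by_contra hB
          refine h (iterate_evolve_of_free (hσ m fun hm => hB ?_) t).symm
          obtain ⟨h1, h2⟩ := hm
          simp only [B, Finset.mem_product, Finset.mem_Icc]
          omega
        have : m ∈ B.filter fun m => ((evolve T)^[t + 1] σ m).2 ≠ free := by
          rw [heq]
          exact Finset.mem_filter.2 ⟨hB, fun h' => h h'.symm⟩
        rw [Finset.mem_filter, Function.iterate_succ_apply'] at this
        exact this.2 g
  have hsum : ∀ t, f t + t ≤ f 0 := by
    intro t
    induction t with
    | zero => simp
    | succ t ih => have := hf t; omega
  have := hsum (f 0 + 1)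
  omega

lemma stable_of_evolve_eq {T : TileSet} {σ : Skeleton} (h : evolve T σ = σ) (m : ℤ × ℤ) :
    Stable T σ m := by
  by_contra g
  have hm : (σ m).2 = free := by
    rw [← h, evolve, if_neg g]
  refine g ⟨?_, ?_, ?_, ?_, ?_, ?_⟩ <;> simp [hm, needsE, needsN, needsW, needsS, Role.flip]

/-! ### Charges from far away -/

/-- The configuration `X` with everything outside `Box R` replaced by free cells of charge `b`. -/
noncomputable def trunc (X : Conf) (R : ℕ) (b : Bool) : Conf :=
  open Classical in fun m => if m ∈ Box R then X m else ((0, free), some b)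

lemma skel_trunc (X : Conf) (R : ℕ) (b b' : Bool) : skel (trunc X R b) = skel (trunc X R b') := by
  funext m
  simp only [skel, trunc]
  split_ifs <;> rfl

lemma adjH_free (fl : Bool) (r : Role) : adjH fl free r = false := by
  cases fl <;> cases r <;> rfl

lemma not_solid_of_free {T : TileSet} {σ : Skeleton} {m : ℤ × ℤ} (h : (σ m).2 = free) :
    ¬ Solid T σ m := fun g => by
  obtain ⟨fl, -, -, a, -⟩ := g.okE.spec
  rw [h, adjH_free] at a
  exact absurd a (by decide)

lemma trunc_of_far {X : Conf} {R : ℕ} {b : Bool} {m : ℤ × ℤ} (hm : 2 * (R : ℤ) < m.1 + m.2) :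
    trunc X R b m = ((0, free), some b) := by
  unfold trunc
  rw [if_neg]
  rintro ⟨h1, h2⟩
  omega

/-- In the half-plane to the north-east of the box, nothing ever changes. -/
lemma iterate_trunc_of_far (T : TileSet) (X : Conf) (R : ℕ) (b : Bool) (t : ℕ) :
    ∀ m : ℤ × ℤ, 2 * (R : ℤ) < m.1 + m.2 → ((step T)^[t] (trunc X R b) m).2 = some b := by
  induction t with
  | zero => intro m hm; simp [trunc_of_far hm]
  | succ t ih =>
    intro m hm
    have hfree : (skel ((step T)^[t] (trunc X R b)) m).2 = free := by
      rw [skel_iterate_step]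
      exact iterate_evolve_of_free (by simp [skel, trunc_of_far hm]) t
    rw [Function.iterate_succ_apply', step_charge, if_neg (not_solid_of_free hfree),
      ih (east m) (by simp only [east]; omega)]
    rfl

/-- Once the skeleton is constant, the charge of a cell that is not solid comes from a path of such
cells leading to the north-east, and so finally from outside the box. -/
theorem charge_eventually {T : TileSet} {X : Conf} {R τ : ℕ} {b : Bool} {σ : Skeleton}
    (hσ : (evolve T)^[τ] (skel (trunc X R b)) = σ) (hfix : evolve T σ = σ) (L : ℕ) :
    ∀ m : ℤ × ℤ, ¬ Solid T σ m → 2 * (R : ℤ) < m.1 + m.2 + L → ∀ t, τ + 1 + L ≤ t →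
      ((step T)^[t] (trunc X R b) m).2 = some b := by
  have hsk : ∀ t, τ ≤ t → skel ((step T)^[t] (trunc X R b)) = σ := by
    intro t ht
    obtain ⟨u, rfl⟩ := Nat.exists_eq_add_of_le' ht
    rw [skel_iterate_step, Function.iterate_add_apply, hσ, Function.iterate_fixed hfix]
  induction L with
  | zero => intro m _ hm t _; exact iterate_trunc_of_far T X R b t m (by simpa using hm)
  | succ L ih =>
    intro m hm hL t ht
    obtain ⟨t, rfl⟩ : ∃ u, t = u + 1 := ⟨t - 1, by omega⟩
    rw [Function.iterate_succ_apply', step_charge, hsk t (by omega), if_neg hm]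
    by_cases hE : Solid T σ (east m)
    · have hN : ¬ Solid T σ (north m) := fun hN =>
        hm (solid_of_east_of_north (stable_of_evolve_eq hfix) hE hN)
      have h1 : ((step T)^[t] (trunc X R b) (east m)).2 = none := by
        obtain ⟨t, rfl⟩ : ∃ u, t = u + 1 := ⟨t - 1, by omega⟩
        rw [Function.iterate_succ_apply', step_charge, hsk t (by omega), if_pos hE]
      rw [h1, ih (north m) hN (by simp only [north]; push_cast at hL; omega) t (by omega)]
      rfl
    · rw [ih (east m) hE (by simp only [east]; push_cast at hL; omega) t (by omega)]
      rfl

/-! ### No box is protected if the tile set does not tile the plane -/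

lemma box_induction {k : ℕ} {P : ℤ × ℤ → Prop} (h0 : P (0, 0))
    (h : ∀ m ∈ Box k, P m → P (east m) ∧ P (north m) ∧ P (west m) ∧ P (south m)) :
    ∀ m ∈ Box k, P m := by
  have h1 : ∀ a : ℕ, a ≤ k → P (a, 0) ∧ P (-a, 0) := by
    intro a
    induction a with
    | zero => intro _; simpa using h0
    | succ a ih =>
      intro ha
      obtain ⟨h1, h2⟩ := ih (by omega)
      have h3 := (h _ ⟨by simp only; omega, by simp⟩ h1).1
      have h4 := (h _ ⟨by simp only; omega, by simp⟩ h2).2.2.1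
      simp only [east, west] at h3 h4
      push_cast
      exact ⟨h3, by rwa [neg_add, ← sub_eq_add_neg]⟩
  have h2 : ∀ i : ℤ, i.natAbs ≤ k → P (i, 0) := by
    intro i hi
    rcases Int.natAbs_eq i with g | g <;> rw [g]
    · exact (h1 _ hi).1
    · exact (h1 _ hi).2
  have h3 : ∀ i : ℤ, i.natAbs ≤ k → ∀ a : ℕ, a ≤ k → P (i, a) ∧ P (i, -a) := by
    intro i hi a
    induction a with
    | zero => intro _; simpa using h2 i hi
    | succ a ih =>
      intro ha
      obtain ⟨h1, h2⟩ := ih (by omega)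
      have h3 := (h _ ⟨hi, by simp only; omega⟩ h1).2.1
      have h4 := (h _ ⟨hi, by simp only; omega⟩ h2).2.2.2
      simp only [north, south] at h3 h4
      push_cast
      exact ⟨h3, by rwa [neg_add, ← sub_eq_add_neg]⟩
  rintro ⟨i, j⟩ ⟨hi, hj⟩
  rcases Int.natAbs_eq j with g | g <;> rw [g]
  · exact (h3 i hi _ hj).1
  · exact (h3 i hi _ hj).2

/-- The tiles of a solid box are either all blank or all proper. -/
lemma blank_iff_of_solid {T : TileSet} {σ : Skeleton} {k : ℕ} (h : ∀ m ∈ Box k, Solid T σ m) :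
    ∀ m ∈ Box k, (σ m).1 = T.numTiles ↔ (σ (0, 0)).1 = T.numTiles := by
  have hE : ∀ m, OkE T σ m → ((σ m).1 = T.numTiles ↔ (σ (east m)).1 = T.numTiles) := by
    intro m hm
    obtain ⟨fl, p, q, -⟩ := hm.spec
    rw [p, decide_eq_decide] at q
    exact not_iff_not.1 q
  have hN : ∀ m, OkN T σ m → ((σ m).1 = T.numTiles ↔ (σ (north m)).1 = T.numTiles) := by
    intro m hm
    obtain ⟨fl, p, q, -⟩ := hm.spec
    rw [p, decide_eq_decide] at q
    exact not_iff_not.1 q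
  refine box_induction Iff.rfl fun m hm hP => ⟨?_, ?_, ?_, ?_⟩
  · rw [← hE m (h m hm).okE, hP]
  · rw [← hN m (h m hm).okN, hP]
  · rw [hE _ (h m hm).okW, east_west, hP]
  · rw [hN _ (h m hm).okS, north_south, hP]

lemma eq_core_of_adj : ∀ r : Role, (∃ r', adjH false r r' = true) → (∃ r', adjH false r' r = true) →
    (∃ r', adjV false r r' = true) → (∃ r', adjV false r' r = true) → r = core := by decide

lemma Solid.eq_core {T : TileSet} {σ : Skeleton} {m : ℤ × ℤ} (h : Solid T σ m)
    (hm : (σ m).1 = T.numTiles) : (σ m).2 = core := by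
  obtain ⟨f1, p1, -, a1, -⟩ := h.okE.spec
  obtain ⟨f2, p2, -, a2, -⟩ := h.okN.spec
  obtain ⟨f3, -, p3, a3, -⟩ := h.okW.spec
  obtain ⟨f4, -, p4, a4, -⟩ := h.okS.spec
  rw [east_west] at p3 a3
  rw [north_south] at p4 a4
  simp only [hm, ne_eq, not_true_eq_false, decide_false] at p1 p2 p3 p4
  subst p1 p2 p3 p4
  exact eq_core_of_adj _ ⟨_, a1⟩ ⟨_, a3⟩ ⟨_, a2⟩ ⟨_, a4⟩

/-- A solid box of proper tiles is a tiling of the box. -/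
lemma exists_tiling_of_solid {T : TileSet} {σ : Skeleton} {k : ℕ} (h : ∀ m ∈ Box k, Solid T σ m)
    (h0 : (σ (0, 0)).1 ≠ T.numTiles) :
    ∃ t : ℤ × ℤ → Fin T.numTiles, ∀ m ∈ Box k,
      ((t m : ℕ), (t (east m) : ℕ)) ∈ T.horiz ∧ ((t m : ℕ), (t (north m) : ℕ)) ∈ T.vert := by
  have hE : ∀ m ∈ Box k, (σ m).1 < T.numTiles ∧
      (σ (east m)).1 < T.numTiles ∧ ((σ m).1, (σ (east m)).1) ∈ T.horiz := by
    intro m hm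
    obtain ⟨fl, p, -, -, g⟩ := (h m hm).okE.spec
    exact g (by rw [p, decide_eq_true_eq, Ne, blank_iff_of_solid h m hm]; exact h0)
  have hN : ∀ m ∈ Box k, (σ m).1 < T.numTiles ∧
      (σ (north m)).1 < T.numTiles ∧ ((σ m).1, (σ (north m)).1) ∈ T.vert := by
    intro m hm
    obtain ⟨fl, p, -, -, g⟩ := (h m hm).okN.spec
    exact g (by rw [p, decide_eq_true_eq, Ne, blank_iff_of_solid h m hm]; exact h0)
  have hpos := (hE (0, 0) ⟨by simp, by simp⟩).1
  refine ⟨fun m => if hm : (σ m).1 < T.numTiles then ⟨(σ m).1, hm⟩ else ⟨_, hpos⟩,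
    fun m hm => ?_⟩
  obtain ⟨e1, e2, e3⟩ := hE m hm
  obtain ⟨n1, n2, n3⟩ := hN m hm
  simp only [e1, e2, n2, dif_pos]
  exact ⟨e3, n3⟩

/-- If `T` does not tile the plane, then around any configuration some box is reached, with either
charge, from arbitrarily far away. Otherwise, every box is solid in the final skeleton of some
truncation. Large solid boxes are plain, so every cell is a core cell; but a truncated plane of core
cells has no stable eastern boundary. -/
theorem exists_charge_eq {T : TileSet} (hT : ¬ T.TilesPlane) (X : Conf) :
    ∃ k : ℕ, ∀ R : ℕ, ∃ c ∈ Box k, ∃ t, ∀ b, ((step T)^[t] (trunc X R b) c).2 = some b := by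
  by_contra! hcon
  have key : ∀ k : ℕ, ∃ (R : ℕ) (σ : Skeleton), (∀ m, Stable T σ m) ∧ (∀ m ∈ Box k, Solid T σ m) ∧
      (∀ m, m ∉ Box R → (σ m).2 = free) ∧ ∀ m, (σ m).2 ≠ free → (σ m).2 = (X m).1.2 := by
    intro k
    obtain ⟨R, hR⟩ := hcon k
    have hout : ∀ m, m ∉ Box R → (skel (trunc X R true) m).2 = free := fun m hm => by
      simp [skel, trunc, hm]
    obtain ⟨τ, hτ⟩ := exists_evolve_fixed T hout
    refine ⟨R, _, stable_of_evolve_eq hτ, fun m hm => ?_, fun m hm =>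
      iterate_evolve_of_free (hout m hm) τ, fun m hm => ?_⟩
    · by_contra hns
      obtain ⟨b, hb⟩ := hR m hm (τ + 1 + (2 * R - m.1 - m.2 + 1).toNat)
      -- Each step of the path from `m` raises the sum of the coordinates by one, and beyond `2 * R`
      -- the path has left the box.
      exact hb (charge_eventually (by rw [skel_trunc X R b true]) hτ _ m hns (by omega) _ le_rfl)
    · have h1 := (iterate_evolve_snd T (skel (trunc X R true)) τ m).resolve_right hm
      have hmR : m ∈ Box R := by
        by_contra g
        exact hm (iterate_evolve_of_free (hout m g) τ)
      rw [h1, skel, trunc, if_pos hmR]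
  obtain ⟨k₀, hk₀⟩ : ∃ k : ℕ, ¬ ∃ t : ℤ × ℤ → Fin T.numTiles, ∀ m ∈ Box k,
      ((t m : ℕ), (t (east m) : ℕ)) ∈ T.horiz ∧ ((t m : ℕ), (t (north m) : ℕ)) ∈ T.vert := by
    by_contra! g
    exact hT (tilesPlane_of_forall_box g)
  have hcore : ∀ m, (X m).1.2 = core := by
    intro m
    obtain ⟨R, σ, -, hsol, -, hX⟩ := key (max k₀ (max m.1.natAbs m.2.natAbs))
    have hm : m ∈ Box (max k₀ (max m.1.natAbs m.2.natAbs)) := ⟨by omega, by omega⟩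
    have h0 : (σ (0, 0)).1 = T.numTiles := by
      by_contra h0
      refine hk₀ (exists_tiling_of_solid (fun m' hm' => hsol m' ?_) h0)
      exact ⟨hm'.1.trans (le_max_left _ _), hm'.2.trans (le_max_left _ _)⟩
    have hc := (hsol m hm).eq_core ((blank_iff_of_solid hsol m hm).2 h0)
    rw [← hX m (by rw [hc]; decide), hc]
  obtain ⟨R, σ, hst, hsol, hout, hX⟩ := key 0
  -- In the truncation, the core cells to the east of the origin would go on for ever.
  have hray : ∀ a : ℕ, (σ ((a : ℤ), 0)).2 ≠ free := by
    intro a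
    induction a with
    | zero => exact fun h => not_solid_of_free h (hsol _ ⟨by simp, by simp⟩)
    | succ a ih =>
      intro h
      obtain ⟨fl, -, -, hadj, -⟩ := ((hst _).okE (by rw [hX _ ih, hcore]; rfl)).spec
      rw [show east ((a : ℤ), 0) = (((a + 1 : ℕ) : ℤ), 0) by simp [east], h, hX _ ih, hcore] at hadj
      exact absurd hadj (by cases fl <;> decide)
  exact hray (R + 1) (hout _ fun h => by have := h.1; simp only at this; omega)


/-! ### The automaton as a finite datum -/

/-- A numbering of the pairs of a role and a charge. -/
noncomputable def kindEquiv : Role × Option Bool ≃ Fin 30 :=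
  Fintype.equivFinOfCardEq (by decide)

/-- The number of a cell. The cells with tile at most `n` get exactly the numbers below
`30 * (n + 1)`. -/
noncomputable def encode (c : Cell) : ℕ := 30 * c.1.1 + (kindEquiv (c.1.2, c.2) : ℕ)

/-- The cell with a given number. -/
noncomputable def decode (a : ℕ) : Cell :=
  ((a / 30, (kindEquiv.symm (Fin.ofNat 30 a)).1), (kindEquiv.symm (Fin.ofNat 30 a)).2)

lemma decode_encode (c : Cell) : decode (encode c) = c := by
  have h1 : encode c / 30 = c.1.1 := by
    have := (kindEquiv (c.1.2, c.2)).2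
    unfold encode; omega
  have h2 : Fin.ofNat 30 (encode c) = kindEquiv (c.1.2, c.2) := by
    apply Fin.ext
    have := (kindEquiv (c.1.2, c.2)).2
    simp only [Fin.val_ofNat, encode]; omega
  unfold decode
  rw [h1, h2, Equiv.symm_apply_apply]

lemma encode_decode (a : ℕ) : encode (decode a) = a := by
  unfold encode decode
  simp only [Prod.mk.eta, Equiv.apply_symm_apply, Fin.val_ofNat]
  omega

lemma decode_injective : Function.Injective decode :=
  Function.LeftInverse.injective encode_decode

lemma encode_lt {c : Cell} {n : ℕ} : encode c < 30 * n + 29 + 1 ↔ c.1.1 ≤ n := by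
  have := (kindEquiv (c.1.2, c.2)).2
  unfold encode; omega

/-- The local rule on lists of numbers of cells: the cell itself and its eastern, northern, western
and southern neighbours. -/
noncomputable def wordRule (T : TileSet) (v : List ℕ) : ℕ :=
  encode (localCell T (decode (v.getD 0 0)) (decode (v.getD 1 0)) (decode (v.getD 2 0))
    (decode (v.getD 3 0)) (decode (v.getD 4 0)))

/-- The words of length `k` over the alphabet `{0, …, q - 1}`. -/
def words (q : ℕ) : ℕ → List (List ℕ)
  | 0 => [[]]
  | k + 1 => (List.range q).flatMap fun a => (words q k).map (List.cons a)

lemma mem_words {q : ℕ} {v : List ℕ} (h : ∀ a ∈ v, a < q) : v ∈ words q v.length := by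
  induction v with
  | nil => simp [words]
  | cons a v ih =>
    simp only [List.length_cons, words, List.mem_flatMap, List.mem_range, List.mem_map]
    exact ⟨a, h a (by simp), v, ih fun b hb => h b (by simp [hb]), rfl⟩

/-- The cellular automaton associated with a tile set. -/
noncomputable def ringCA (T : TileSet) : PlaneCA where
  lastState := 30 * T.numTiles + 29
  neighborhood := [(0, 0), (1, 0), (0, 1), (-1, 0), (0, -1)]
  table := (words (30 * T.numTiles + 29 + 1) 5).map fun v => (v, wordRule T v)

lemma lookup_map_self (f : List ℕ → ℕ) {v : List ℕ} {l : List (List ℕ)} (h : v ∈ l) :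
    (l.map fun v => (v, f v)).lookup v = some (f v) := by
  induction l with
  | nil => simp at h
  | cons u l ih =>
    rw [List.map_cons, List.lookup_cons]
    by_cases huv : v = u
    · simp [huv]
    · have : (v == u) = false := by simpa using huv
      simp only [this]
      exact ih ((List.mem_cons.1 h).resolve_left huv)

/-- The configuration of cells described by a configuration of `ringCA T`. -/
noncomputable def conf {T : TileSet} (x : (ringCA T).Config) : Conf := fun m => decode (x m)

lemma conf_globalMap {T : TileSet} (x : (ringCA T).Config) :
    conf ((ringCA T).globalMap x) = step T (conf x) := by
  funext m
  set v : List ℕ :=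
    ((ringCA T).neighborhood.map fun u => x (m + u)).map fun a : (ringCA T).State => a.val with hv
  have hv' : v = [(x m).val, (x (east m)).val, (x (north m)).val, (x (west m)).val,
      (x (south m)).val] := by
    have h0 : m + ((0 : ℤ), (0 : ℤ)) = m := by ext <;> simp
    have h1 : m + ((1 : ℤ), (0 : ℤ)) = east m := by ext <;> simp [east]
    have h2 : m + ((0 : ℤ), (1 : ℤ)) = north m := by ext <;> simp [north]
    have h3 : m + ((-1 : ℤ), (0 : ℤ)) = west m := by ext <;> simp [west, sub_eq_add_neg]
    have h4 : m + ((0 : ℤ), (-1 : ℤ)) = south m := by ext <;> simp [south, sub_eq_add_neg]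
    change [(x (m + (0, 0))).val, (x (m + (1, 0))).val, (x (m + (0, 1))).val,
      (x (m + (-1, 0))).val, (x (m + (0, -1))).val] = _
    rw [h0, h1, h2, h3, h4]
  have hmem : v ∈ words (30 * T.numTiles + 29 + 1) 5 := by
    have h5 : v.length = 5 := by rw [hv']; rfl
    rw [← h5]
    refine mem_words fun a ha => ?_
    rw [hv, List.mem_map] at ha
    obtain ⟨b, -, rfl⟩ := ha
    exact b.2
  have hrule : wordRule T v = encode (step T (conf x) m) := by rw [hv']; rfl
  have hlt : wordRule T v < 30 * T.numTiles + 29 + 1 := by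
    -- The rule does not change the tile of a cell.
    rw [hrule, encode_lt]
    have : encode (conf x m) < 30 * T.numTiles + 29 + 1 := by
      rw [conf, encode_decode]; exact (x m).2
    exact (encode_lt (c := conf x m)).1 this
  have hval : ((ringCA T).globalMap x m).val = wordRule T v := by
    have hl : (ringCA T).table.lookup v = some (wordRule T v) := lookup_map_self _ hmem
    simp only [PlaneCA.globalMap, PlaneCA.localRule]
    rw [← hv, hl]
    exact Nat.mod_eq_of_lt hlt
  rw [conf, hval, hrule, decode_encode]

lemma conf_iterate {T : TileSet} (x : (ringCA T).Config) (t : ℕ) :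
    conf ((ringCA T).globalMap^[t] x) = (step T)^[t] (conf x) := by
  induction t with
  | zero => rfl
  | succ t ih => rw [Function.iterate_succ_apply', Function.iterate_succ_apply', conf_globalMap, ih]

lemma exists_conf_eq {T : TileSet} {X : Conf} (hX : ∀ m, (X m).1.1 ≤ T.numTiles) :
    ∃ x : (ringCA T).Config, conf x = X :=
  ⟨fun m => ⟨encode (X m), encode_lt.2 (hX m)⟩, funext fun m => decode_encode (X m)⟩

lemma conf_tile_le {T : TileSet} (x : (ringCA T).Config) (m : ℤ × ℤ) :
    (conf x m).1.1 ≤ T.numTiles := by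
  rw [← encode_lt, conf, encode_decode]; exact (x m).2

lemma conf_eq_iff {T : TileSet} {x y : (ringCA T).Config} {m : ℤ × ℤ} :
    conf x m = conf y m ↔ x m = y m :=
  ⟨fun h => Fin.ext (decode_injective h), fun h => by rw [conf, conf, h]⟩

/-! ### Computability -/

/-- The finite part of the local rule: the new role and charge of a cell in terms of the roles and
charges of the cells in its neighbourhood and of the connections of their tiles. -/
noncomputable def finRule (p : (Fin 30 × Fin 30 × Fin 30 × Fin 30 × Fin 30) ×
    (Option Bool × Option Bool × Option Bool × Option Bool)) : Fin 30 :=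
  let a := kindEquiv.symm p.1.1
  let cE := kindEquiv.symm p.1.2.1
  let cN := kindEquiv.symm p.1.2.2.1
  let cW := kindEquiv.symm p.1.2.2.2.1
  let cS := kindEquiv.symm p.1.2.2.2.2
  let oE := fitsH p.2.1 a.1 cE.1
  let oN := fitsV p.2.2.1 a.1 cN.1
  let oW := fitsH p.2.2.2.1 cW.1 a.1
  let oS := fitsV p.2.2.2.2 cS.1 a.1
  kindEquiv (if settled oE oN oW oS a.1 cE.1 cN.1 cW.1 cS.1 then a.1 else free,
    if oE && oN && oW && oS then none else some ((cE.2 <|> cN.2).getD false))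

lemma wordRule_eq (T : TileSet) (v : List ℕ) :
    wordRule T v = 30 * (v.getD 0 0 / 30) +
      (finRule ((Fin.ofNat 30 (v.getD 0 0), Fin.ofNat 30 (v.getD 1 0), Fin.ofNat 30 (v.getD 2 0),
        Fin.ofNat 30 (v.getD 3 0), Fin.ofNat 30 (v.getD 4 0)),
        (link T.numTiles T.horiz (v.getD 0 0 / 30) (v.getD 1 0 / 30),
        link T.numTiles T.vert (v.getD 0 0 / 30) (v.getD 2 0 / 30),
        link T.numTiles T.horiz (v.getD 3 0 / 30) (v.getD 0 0 / 30),
        link T.numTiles T.vert (v.getD 4 0 / 30) (v.getD 0 0 / 30))) : ℕ) := rfl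

lemma primrec_link {α : Type*} [Primcodable α] {n a b : α → ℕ} {L : α → List (ℕ × ℕ)}
    (hn : Primrec n) (hL : Primrec L) (ha : Primrec a) (hb : Primrec b) :
    Primrec fun x => link (n x) (L x) (a x) (b x) := by
  have hmem : PrimrecPred fun x => (a x, b x) ∈ L x :=
    ((PrimrecRel.exists_mem_list Primrec.eq).comp hL (ha.pair hb)).of_eq fun x => by simp
  exact Primrec.ite ((Primrec.eq.comp ha hn).and (Primrec.eq.comp hb hn)) (Primrec.const _)
    (Primrec.ite ((Primrec.nat_lt.comp ha hn).and ((Primrec.nat_lt.comp hb hn).and hmem))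
      (Primrec.const _) (Primrec.const _))

lemma primrec_ofNat : Primrec (Fin.ofNat 30 : ℕ → Fin 30) :=
  Primrec.fin_val_iff.1 (Primrec.nat_mod.comp Primrec.id (Primrec.const 30))

lemma primrec_numTiles : Primrec TileSet.numTiles :=
  Primrec.fst.comp (Primrec.of_equiv (e := TileSet.equivData))

lemma primrec_horiz : Primrec TileSet.horiz :=
  (Primrec.fst.comp Primrec.snd).comp (Primrec.of_equiv (e := TileSet.equivData))

lemma primrec_vert : Primrec TileSet.vert :=
  (Primrec.snd.comp Primrec.snd).comp (Primrec.of_equiv (e := TileSet.equivData))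

lemma primrec_wordRule : Primrec₂ wordRule := by
  have hg (i : ℕ) : Primrec fun p : TileSet × List ℕ => p.2.getD i 0 :=
    (Primrec.list_getD 0).comp Primrec.snd (Primrec.const i)
  have hk (i : ℕ) : Primrec fun p : TileSet × List ℕ => Fin.ofNat 30 (p.2.getD i 0) :=
    primrec_ofNat.comp (hg i)
  have ht (i : ℕ) : Primrec fun p : TileSet × List ℕ => p.2.getD i 0 / 30 :=
    Primrec.nat_div.comp (hg i) (Primrec.const 30)
  have hn := primrec_numTiles.comp (Primrec.fst (α := TileSet) (β := List ℕ))
  have hh := primrec_horiz.comp (Primrec.fst (α := TileSet) (β := List ℕ))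
  have hv := primrec_vert.comp (Primrec.fst (α := TileSet) (β := List ℕ))
  have hfin := (Primrec.dom_finite finRule).comp
    (((hk 0).pair ((hk 1).pair ((hk 2).pair ((hk 3).pair (hk 4))))).pair
      ((primrec_link hn hh (ht 0) (ht 1)).pair ((primrec_link hn hv (ht 0) (ht 2)).pair
        ((primrec_link hn hh (ht 3) (ht 0)).pair (primrec_link hn hv (ht 4) (ht 0))))))
  exact (Primrec.nat_add.comp (Primrec.nat_mul.comp (Primrec.const 30) (ht 0))
    (Primrec.fin_val.comp hfin)).of_eq fun p => (wordRule_eq p.1 p.2).symm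

lemma primrec_words (k : ℕ) : Primrec fun q => words q k := by
  induction k with
  | zero => exact Primrec.const _
  | succ k ih =>
    refine Primrec.list_flatMap Primrec.list_range ?_
    exact Primrec.list_map (ih.comp Primrec.fst)
      (Primrec.list_cons.comp (Primrec.snd.comp Primrec.fst) Primrec.snd).to₂

lemma computable_ringCA : Computable ringCA := by
  have hq : Primrec fun T : TileSet => 30 * T.numTiles + 29 :=
    Primrec.nat_add.comp (Primrec.nat_mul.comp (Primrec.const 30) primrec_numTiles)
      (Primrec.const 29)
  have ht : Primrec fun T : TileSet =>
      (words (30 * T.numTiles + 29 + 1) 5).map fun v => (v, wordRule T v) :=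
    Primrec.list_map ((primrec_words 5).comp (Primrec.succ.comp hq))
      (Primrec.snd.pair (primrec_wordRule.comp Primrec.fst Primrec.snd)).to₂
  exact ((Primrec.of_equiv_symm (e := PlaneCA.equivData)).comp
    (hq.pair ((Primrec.const [(0, 0), (1, 0), (0, 1), (-1, 0), (0, -1)]).pair ht))).to_comp

/-! ### The topological dynamics of the automaton -/

lemma configDist_lt_iff {A : Type*} {x y : ℤ × ℤ → A} {k : ℕ} :
    configDist x y < (1 / 2 : ℝ) ^ k ↔ ∀ m ∈ Box k, x m = y m := by
  unfold configDist
  split_ifs with h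
  · simp [h]
  · rw [pow_lt_pow_iff_right_of_lt_one₀ (by norm_num) (by norm_num)]
    set S := {k : ℕ | ∃ i : ℤ × ℤ, x i ≠ y i ∧ k = max i.1.natAbs i.2.natAbs} with hS
    have hne : S.Nonempty := by
      obtain ⟨i, hi⟩ := Function.ne_iff.1 h
      exact ⟨_, i, hi, rfl⟩
    constructor
    · intro hk m hm
      by_contra hxy
      have h1 : sInf S ≤ max m.1.natAbs m.2.natAbs := Nat.sInf_le ⟨m, hxy, rfl⟩
      have h2 : max m.1.natAbs m.2.natAbs ≤ k := max_le hm.1 hm.2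
      omega
    · intro hk
      obtain ⟨i, hi, hi'⟩ := Nat.sInf_mem hne
      by_contra! hle
      exact hi (hk i ⟨by omega, by omega⟩)

lemma exists_half_pow_lt {ε : ℝ} (hε : 0 < ε) : ∃ k : ℕ, (1 / 2 : ℝ) ^ k < ε :=
  exists_pow_lt_of_lt_one hε (by norm_num)

/-- An initial pattern on `Box (k + 1)` that fixes the evolution on `Box k` keeps close
configurations close. -/
lemma configDist_iterate_lt {T : TileSet} {σ : Skeleton} {k : ℕ}
    (h : ∀ Y : Conf, (∀ m ∈ Box (k + 1), Y m = (σ m, none)) → ∀ t, ∀ m ∈ Box k,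
      (step T)^[t] Y m = (σ m, none))
    {x y : (ringCA T).Config} (hx : conf x = fun m => (σ m, none))
    (hxy : configDist x y < (1 / 2 : ℝ) ^ (k + 1)) (t : ℕ) :
    configDist ((ringCA T).globalMap^[t] x) ((ringCA T).globalMap^[t] y) < (1 / 2 : ℝ) ^ k := by
  rw [configDist_lt_iff] at hxy ⊢
  intro m hm
  rw [← conf_eq_iff, conf_iterate, conf_iterate, h _ (fun m _ => by rw [hx]) t m hm,
    h _ (fun m hm => by rw [conf_eq_iff.2 (hxy m hm).symm, hx]) t m hm]

theorem ringCA_mem_classEq {T : TileSet} (hT : T.TilesPlane) : ringCA T ∈ PlaneCA.classEq := by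
  obtain ⟨t, ht⟩ := hT
  obtain ⟨x, hx⟩ := exists_conf_eq (T := T) (X := fun m => (ringSkel t m, none))
    fun m => (t m).2.le
  refine ⟨x, fun ε hε => ?_⟩
  obtain ⟨k, hk⟩ := exists_half_pow_lt hε
  refine ⟨(1 / 2) ^ (k + 1), by positivity, fun y hy n => ?_⟩
  exact (configDist_iterate_lt (fun Y hY => ring_protected ht hY) hx hy n).trans hk

theorem ringCA_notMem_classS (T : TileSet) : ringCA T ∉ PlaneCA.classS := by
  rintro ⟨ε, hε, h⟩
  obtain ⟨k, hk⟩ := exists_half_pow_lt hε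
  obtain ⟨x, hx⟩ := exists_conf_eq (T := T) (X := fun m => (blockSkel T k m, none))
    fun m => le_rfl
  obtain ⟨y, n, hy, hn⟩ := h ((1 / 2) ^ (k + 1)) (by positivity) x
  have := configDist_iterate_lt (fun Y hY => block_protected T hY) hx hy n
  linarith

theorem ringCA_notMem_classEq {T : TileSet} (hT : ¬ T.TilesPlane) :
    ringCA T ∉ PlaneCA.classEq := by
  rintro ⟨x, hx⟩
  obtain ⟨k, hk⟩ := exists_charge_eq hT (conf x)
  obtain ⟨δ, hδ, h⟩ := hx ((1 / 2) ^ k) (by positivity)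
  obtain ⟨R, hR⟩ := exists_half_pow_lt hδ
  obtain ⟨c, hc, t, ht⟩ := hk R
  have key : ∀ b, (conf ((ringCA T).globalMap^[t] x) c).2 = some b := by
    intro b
    obtain ⟨y, hy⟩ := exists_conf_eq (T := T) (X := trunc (conf x) R b) fun m => by
      unfold trunc
      split_ifs
      · exact conf_tile_le x m
      · exact Nat.zero_le _
    have hxy : configDist x y < δ := by
      refine lt_trans (configDist_lt_iff.2 fun m hm => ?_) hR
      rw [← conf_eq_iff, hy, trunc, if_pos hm]
    rw [conf_eq_iff.2 (configDist_lt_iff.1 (h y hxy t) c hc), conf_iterate, hy, ht b]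
  exact absurd ((key true).symm.trans (key false)) (by decide)

end RingCA

theorem mainTheorem6 :
    ∃ Φ : TileSet → PlaneCA, Computable Φ ∧
      ∀ T : TileSet,
        (T.TilesPlane → Φ T ∈ PlaneCA.classEq) ∧
        (¬ T.TilesPlane → Φ T ∈ PlaneCA.classN) :=
  ⟨RingCA.ringCA, RingCA.computable_ringCA, fun T => ⟨RingCA.ringCA_mem_classEq, fun hT =>
    ⟨RingCA.ringCA_notMem_classEq hT, RingCA.ringCA_notMem_classS T⟩⟩⟩
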